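/- Let $X$ and $Z$ be complex Hilbert spaces, let $E\in L(X,Z)$ be bounded and let $A:X\supseteq D(A)\to Z$ be a closed, densely defined linear operator. Put $\rho(E,A)=\{\lambda\in\mathbb{C}:\ \lambda E-A:D(A)\to Z \text{ is bijective}\}$, and define $\rho(E^*,A^*)$ in the same way with $E^*\in L(Z,X)$ and $A^*:Z\supseteq D(A^*)\to X$. Assume $0\in\rho(A)$, i.e. $A:D(A)\to Z$ is bijective (hence boundedly invertible). Then $0\in\rho(E,A)$. If, moreover, there is $\omega>0$ such that $$\mathrm{Re}\langle Ax,Ex\rangle_Z\le-\omega\|Ex\|^2\quad (x\in D(A)),\qquad \mathrm{Re}\langle A^*z,E^*z\rangle_X\le-\omega\|E^*z\|^2\quad (z\in D(A^*)),$$ then: 1. $(-\omega,\infty)\subseteq\rho(E,A)$ and $(-\omega,\infty)\subseteq\rho(E^*,A^*)$; 2. $\|E(\lambda E-A)^{-1}\|\le(\lambda+\omega)^{-1}$ for all real $\lambda>-\omega$; 3. $\|(\lambda E-A)^{-1}E\|\le(\lambda+\omega)^{-1}$ for all real $\lambda>-\omega$. In particular, the degenerate semigroup $(T(t))_{t\ge0}$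 associated with the pseudo-resolvent $R(\lambda)=(A-\lambda E)^{-1}E$, $\lambda\in\rho(E,A)$, exists, is unique, and is exponentially stable: there are $M,\delta>0$ with $\|T(t)\|\le Me^{-\delta t}$ for all $t\ge0$. Here a degenerate semigroup is a family $T(t)\in L(X)$, $t\ge0$, with $T(t+s)=T(t)T(s)$ for $t,s>0$, strongly continuous on $(0,\infty)$, bounded on $(0,1]$, and with $T(0)x=\lim_{t\downarrow0}T(t)x$ for all $x\in X$. It is associated with $R$ if, for every $\lambda\in\rho(E,A)$, $T(0)$ is the projection onto $X_R=\overline{\mathrm{ran}\,R(\lambda)}$ along $X_K=\ker R(\lambda)$, and the generator of the $C_0$-semigroup $(T(t)|_{X_R})_{t\ge0}$ is the operator $A_R$ on $X_R$ with graph $\{(R(\lambda)x,\ x+\lambda R(\lambda)x): x\in X_R\}$. -/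

import Mathlib

open scoped NNReal Topology

section Pencil

variable {X Z : Type*}
  [NormedAddCommGroup X] [InnerProductSpace ℂ X] [CompleteSpace X]
  [NormedAddCommGroup Z] [InnerProductSpace ℂ Z] [CompleteSpace Z]

/-- The operator `l E - A : D(A) → Z`, for `E` bounded and `A` possibly unbounded. -/
def pencil (E : X →L[ℂ] Z) (A : X →ₗ.[ℂ] Z) (l : ℂ) : A.domain →ₗ[ℂ] Z :=
  l • ((E : X →ₗ[ℂ] Z) ∘ₗ A.domain.subtype) - A.toFun

/-- The resolvent set `ρ(E, A)`: all `l` such that `l E - A : D(A) → Z` is bijective. -/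
def pencilResolventSet (E : X →L[ℂ] Z) (A : X →ₗ.[ℂ] Z) : Set ℂ :=
  {l | Function.Bijective (pencil E A l)}

/-- The inverse `(l E - A)⁻¹ : Z → X` as a linear map, for `l ∈ ρ(E, A)`. -/
noncomputable def pencilInverseLin (E : X →L[ℂ] Z) (A : X →ₗ.[ℂ] Z) (l : ℂ)
    (hl : l ∈ pencilResolventSet E A) : Z →ₗ[ℂ] X :=
  A.domain.subtype ∘ₗ
    ((LinearEquiv.ofBijective (pencil E A l) hl).symm : Z →ₗ[ℂ] A.domain)

/-- For closed `A` the inverse of `l E - A` is bounded (closed graph theorem). -/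
theorem pencilInverseLin_continuous (E : X →L[ℂ] Z) (A : X →ₗ.[ℂ] Z) (l : ℂ)
    (hA : A.IsClosed) (hl : l ∈ pencilResolventSet E A) :
    Continuous (pencilInverseLin E A l hl) := by
  apply LinearMap.continuous_of_isClosed_graph
  have hc : Continuous (fun p : Z × X => (p.2, l • E p.2 - p.1)) := by fun_prop
  have key : ((pencilInverseLin E A l hl).graph : Set (Z × X)) =
      (fun p : Z × X => (p.2, l • E p.2 - p.1)) ⁻¹' (A.graph : Set (X × Z)) := by
    ext ⟨z, x⟩
    simp only [SetLike.mem_coe, LinearMap.mem_graph_iff, Set.mem_preimage,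
      LinearPMap.mem_graph_iff]
    constructor
    · intro h
      refine ⟨(LinearEquiv.ofBijective (pencil E A l) hl).symm z, h.symm, ?_⟩
      have h1 : pencil E A l ((LinearEquiv.ofBijective (pencil E A l) hl).symm z) = z :=
        (LinearEquiv.ofBijective (pencil E A l) hl).apply_symm_apply z
      have h2 : l • E x - A ((LinearEquiv.ofBijective (pencil E A l) hl).symm z) = z := by
        rw [h]; exact h1
      exact eq_sub_of_add_eq (sub_eq_iff_eq_add'.mp h2).symm
    · rintro ⟨y, rfl, hy⟩
      have h1 : z = pencil E A l y := by
        change z = l • E (y : X) - A y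
        rw [hy]; abel
      have h2 : (LinearEquiv.ofBijective (pencil E A l) hl).symm z = y := by
        rw [LinearEquiv.symm_apply_eq]; exact h1
      change (y : X) = ((LinearEquiv.ofBijective (pencil E A l) hl).symm z : A.domain)
      rw [h2]
  rw [key]
  exact IsClosed.preimage hc hA

open Classical in
/-- The bounded operator `(l E - A)⁻¹ : Z → X`, for closed `A` and `l ∈ ρ(E, A)`
(and, by convention, `0` otherwise). -/
noncomputable def pencilInverse (E : X →L[ℂ] Z) (A : X →ₗ.[ℂ] Z) (l : ℂ) : Z →L[ℂ] X :=
  if h : A.IsClosed ∧ l ∈ pencilResolventSet E A then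
    ⟨pencilInverseLin E A l h.2, pencilInverseLin_continuous E A l h.1 h.2⟩
  else 0

/-- The right pseudo-resolvent `(A - l E)⁻¹ E = -((l E - A)⁻¹ E)` on `X`. -/
noncomputable def rightPseudoResolvent (E : X →L[ℂ] Z) (A : X →ₗ.[ℂ] Z) (l : ℂ) :
    X →L[ℂ] X :=
  (-pencilInverse E A l) ∘L E

end Pencil

section Semigroup

variable {X : Type*} [NormedAddCommGroup X] [InnerProductSpace ℂ X]

/-- Strongly continuous degenerate semigroups: the semigroup law and strong continuity on
`(0, ∞)`, boundedness on `(0, 1]`, and `T 0` is the strong limit of `T t` as `t ↓ 0`.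
`T 0` need not be the identity. -/
structure IsDegenerateSemigroup (T : ℝ≥0 → X →L[ℂ] X) : Prop where
  map_add : ∀ t s : ℝ≥0, 0 < t → 0 < s → T (t + s) = T t ∘L T s
  continuousOn : ∀ x : X, ContinuousOn (fun t => T t x) (Set.Ioi 0)
  bounded : ∃ C : ℝ, ∀ t : ℝ≥0, 0 < t → t ≤ 1 → ‖T t‖ ≤ C
  tendsto_zero : ∀ x : X, Filter.Tendsto (fun t => T t x) (𝓝[>] 0) (𝓝 (T 0 x))

/-- The graph of the infinitesimal generator of the restriction of `T` to `ran (T 0)`. -/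
def generatorGraph (T : ℝ≥0 → X →L[ℂ] X) : Set (X × X) :=
  {p | p.1 ∈ (T 0).range ∧ p.2 ∈ (T 0).range ∧
    Filter.Tendsto (fun t : ℝ≥0 => ((t : ℝ)⁻¹ : ℂ) • (T t p.1 - p.1)) (𝓝[>] 0) (𝓝 p.2)}

/-- The graph `{(R(l) x, x + l R(l) x) : x ∈ closure (ran R(l))}` of the operator `A_R` attached
to `R`, written with the evaluation point `l`. The sign is the one for pseudo-resolvents
normalised as `R(l) = (A - l E)⁻¹ E`: if `E = I` it is the graph of `A`. -/
def pseudoResolventGraph (R : ℂ → X →L[ℂ] X) (l : ℂ) : Set (X × X) :=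
  {p | ∃ x ∈ (R l).range.topologicalClosure, p = (R l x, x + l • R l x)}

/-- `T` is the degenerate semigroup associated with `R : Ω → L(X)`: `T 0` is the projection onto
`X_R = closure (ran R(l))` along `X_K = ker R(l)`, and the generator of the restriction of `T`
to `X_R` is `A_R`. So `T t (x₀ + x₁) = T_R t x₁` for `x₀ ∈ X_K`, `x₁ ∈ X_R`, where `T_R` is the
`C₀`-semigroup on `X_R` generated by `A_R`. -/
structure IsAssociatedSemigroup (R : ℂ → X →L[ℂ] X) (Ω : Set ℂ)
    (T : ℝ≥0 → X →L[ℂ] X) : Prop where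
  degenerate : IsDegenerateSemigroup T
  ker_eq : ∀ l ∈ Ω, (T 0).ker = (R l).ker
  range_eq : ∀ l ∈ Ω, (T 0).range = (R l).range.topologicalClosure
  generator_eq : ∀ l ∈ Ω, generatorGraph T = pseudoResolventGraph R l

/-- Exponential stability. -/
def IsExponentiallyStable (T : ℝ≥0 → X →L[ℂ] X) : Prop :=
  ∃ M δ : ℝ, 0 < M ∧ 0 < δ ∧ ∀ t : ℝ≥0, ‖T t‖ ≤ M * Real.exp (-δ * t)

end Semigroup

/-! Everything is read off from the bounded operators `K = E A⁻¹` on `Z` and `L = A⁻¹ E` on `X`.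
Substituting `z = Ax` turns the first hypothesis into `Re⟨z, Kz⟩ ≤ -ω‖Kz‖²`; the second one says the
same of `E* (A*)⁻¹ = L*`. This inequality for `M` is equivalent to `‖1 + 2ωM‖ ≤ 1`, hence passes to
adjoints, so `L` satisfies it too. A Neumann series inverts `1 - lM` for `l > -ω`, and
Cauchy–Schwarz gives `(l + ω)‖My‖ ≤ ‖y - lMy‖`. Since `lE - A = -(1 - lK)A`, claims 1 to 3 follow.

For the semigroup, `ker L = ker L* = (ran L)ᗮ`, so `X` splits orthogonally into `ker L` and the
closure of `ran L`. The kernel, range and graph conditions at every point of `ρ(E, A)` reduce to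
those at `0`: the generator must be the inverse of `L` on the closure of `ran L`. Yosida
approximations of this inverse produce the semigroup. Uniqueness and decay come from one energy
estimate: an orbit derivative `g` satisfies `w = L g`, so `Re⟨w, g⟩ ≤ -ω‖w‖²`. -/

/-! ### Dissipativity expressed through a bounded inverse -/

section InverseDissipative

variable {H : Type*} [NormedAddCommGroup H] [InnerProductSpace ℂ H]

/-- `M` is the (possibly degenerate) inverse of an operator whose shift by `ω` is dissipative. -/
def InverseDissipative (ω : ℝ) (M : H →L[ℂ] H) : Prop :=
  ∀ x, (inner ℂ x (M x)).re ≤ -ω * ‖M x‖ ^ 2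

theorem norm_sq_add_smul (c : ℝ) (x y : H) :
    ‖x + (c : ℂ) • y‖ ^ 2 = ‖x‖ ^ 2 + 2 * c * (inner ℂ x y).re + c ^ 2 * ‖y‖ ^ 2 := by
  rw [@norm_add_sq ℂ, inner_smul_right, norm_smul]
  simp [mul_pow]
  ring

/-- Expanding the square, `‖x + 2ωMx‖² - ‖x‖² = 4ω(Re⟨x, Mx⟩ + ω‖Mx‖²)`. The norm form is manifestly
stable under adjoints and feeds the Neumann series. -/
theorem inverseDissipative_iff_norm_le {ω : ℝ} (hω : 0 < ω) (M : H →L[ℂ] H) :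
    InverseDissipative ω M ↔ ‖1 + ((2 * ω : ℝ) : ℂ) • M‖ ≤ 1 := by
  rw [ContinuousLinearMap.opNorm_le_iff zero_le_one]
  refine forall_congr' fun x => ?_
  have h := norm_sq_add_smul (2 * ω) x (M x)
  have e : (1 + ((2 * ω : ℝ) : ℂ) • M) x = x + ((2 * ω : ℝ) : ℂ) • M x := by simp
  rw [e, one_mul, ← sq_le_sq₀ (norm_nonneg _) (norm_nonneg _), h]
  constructor
  · intro h'; nlinarith
  · intro h'
    have : 0 ≤ (4 * ω) * (-ω * ‖M x‖ ^ 2 - (inner ℂ x (M x)).re) := by nlinarith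
    have := nonneg_of_mul_nonneg_right this (by positivity)
    linarith

theorem InverseDissipative.adjoint [CompleteSpace H] {ω : ℝ} (hω : 0 < ω) {M : H →L[ℂ] H}
    (h : InverseDissipative ω M) : InverseDissipative ω (ContinuousLinearMap.adjoint M) := by
  rw [inverseDissipative_iff_norm_le hω] at h ⊢
  have e : 1 + ((2 * ω : ℝ) : ℂ) • ContinuousLinearMap.adjoint M
      = star (1 + ((2 * ω : ℝ) : ℂ) • M) := by
    rw [star_add, star_one, star_smul, ContinuousLinearMap.star_eq_adjoint]
    simp
  rw [e, norm_star]
  exact h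

theorem InverseDissipative.isUnit_one_sub [CompleteSpace H] {ω : ℝ} (hω : 0 < ω)
    {M : H →L[ℂ] H} (h : InverseDissipative ω M) {l : ℝ} (hl : -ω < l) :
    IsUnit (1 - (l : ℂ) • M) := by
  rw [inverseDissipative_iff_norm_le hω] at h
  set C := 1 + ((2 * ω : ℝ) : ℂ) • M with hC
  have hpos : 0 < 2 * ω + l := by linarith
  have hn : ‖((l / (2 * ω + l) : ℝ) : ℂ) • C‖ < 1 := by
    rw [norm_smul, Complex.norm_real, Real.norm_eq_abs, abs_div, abs_of_pos hpos]
    have : |l| / (2 * ω + l) < 1 := by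
      rw [div_lt_one hpos, abs_lt]; constructor <;> linarith
    calc _ ≤ |l| / (2 * ω + l) * 1 := by gcongr
      _ < 1 := by linarith
  have hu := isUnit_one_sub_of_norm_lt_one hn
  have hne : (((2 * ω + l) / (2 * ω) : ℝ) : ℂ) ≠ 0 := by
    rw [Complex.ofReal_ne_zero]; positivity
  -- Solving `C = 1 + 2ωM` for `M` leaves a scalar multiple of `1 - l/(2ω + l) C`, whose coefficient
  -- has modulus below `1` because `l > -ω`.
  have e : 1 - (l : ℂ) • M =
      (((2 * ω + l) / (2 * ω) : ℝ) : ℂ) • (1 - ((l / (2 * ω + l) : ℝ) : ℂ) • C) := by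
    have h1 : (((2 * ω + l) / (2 * ω) : ℝ) : ℂ) - (((2 * ω + l) / (2 * ω) : ℝ) : ℂ) *
        ((l / (2 * ω + l) : ℝ) : ℂ) = 1 := by
      norm_cast; field_simp; ring
    have h2 : (((2 * ω + l) / (2 * ω) : ℝ) : ℂ) * ((l / (2 * ω + l) : ℝ) : ℂ) *
        ((2 * ω : ℝ) : ℂ) = l := by
      norm_cast; field_simp
    rw [hC, smul_sub, smul_smul, smul_add, smul_smul, h2, ← sub_sub, ← sub_smul, h1, one_smul]
  rw [e]
  exact hu.smul (Units.mk0 _ hne)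

/-- Cauchy–Schwarz for `y - lMy` against `-My`, then division by `‖My‖`. -/
theorem InverseDissipative.mul_norm_le {ω : ℝ} {M : H →L[ℂ] H} (h : InverseDissipative ω M)
    (l : ℝ) (y : H) : (l + ω) * ‖M y‖ ≤ ‖y - (l : ℂ) • M y‖ := by
  rcases eq_or_lt_of_le (norm_nonneg (M y)) with h0 | h0
  · rw [← h0]; simp
  have h1 : (inner ℂ (y - (l : ℂ) • M y) (-M y)).re ≤ ‖y - (l : ℂ) • M y‖ * ‖M y‖ := by
    rw [← norm_neg (M y)]; exact re_inner_le_norm (𝕜 := ℂ) _ _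
  have h2 : (inner ℂ (y - (l : ℂ) • M y) (-M y)).re =
      -(inner ℂ y (M y)).re + l * ‖M y‖ ^ 2 := by
    rw [inner_neg_right, inner_sub_left, inner_smul_left, inner_self_eq_norm_sq_to_K]
    have e : ((((‖M y‖ : ℝ) : ℂ)) ^ 2).re = ‖M y‖ ^ 2 := by norm_cast
    simp [e]
    ring
  have h3 := h y
  rw [h2] at h1
  refine le_of_mul_le_mul_right ?_ h0
  nlinarith

theorem InverseDissipative.re_nonpos {ω : ℝ} (hω : 0 < ω) {M : H →L[ℂ] H}
    (h : InverseDissipative ω M) (x : H) : (inner ℂ x (M x)).re ≤ 0 :=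
  (h x).trans (by have := sq_nonneg ‖M x‖; nlinarith)

/-- If `Mx = 0` then `Re⟨x, M*x⟩ = 0`, and dissipativity of `M*` forces `M*x = 0`. -/
theorem InverseDissipative.apply_eq_zero_iff [CompleteSpace H] {ω : ℝ} (hω : 0 < ω)
    {M : H →L[ℂ] H} (h : InverseDissipative ω M) (x : H) :
    M x = 0 ↔ ContinuousLinearMap.adjoint M x = 0 := by
  have key : ∀ N : H →L[ℂ] H, InverseDissipative ω N → N x = 0 →
      ContinuousLinearMap.adjoint N x = 0 := by
    intro N hN h0
    have h1 := hN.adjoint hω x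
    rw [ContinuousLinearMap.adjoint_inner_right, h0] at h1
    simp only [inner_zero_left, Complex.zero_re, neg_mul, Left.nonneg_neg_iff] at h1
    have : ‖ContinuousLinearMap.adjoint N x‖ ^ 2 = 0 :=
      le_antisymm (by nlinarith) (sq_nonneg _)
    simpa using this
  refine ⟨key M h, fun h' => ?_⟩
  have := key _ (h.adjoint hω) h'
  simpa using this

theorem InverseDissipative.orthogonal_range [CompleteSpace H] {ω : ℝ} (hω : 0 < ω)
    {M : H →L[ℂ] H} (h : InverseDissipative ω M) : M.rangeᗮ = M.ker := by
  rw [ContinuousLinearMap.orthogonal_range]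
  ext x
  simpa using (h.apply_eq_zero_iff hω x).symm

end InverseDissipative

/-! ### Energy estimate -/

section Energy

variable {H : Type*} [NormedAddCommGroup H] [InnerProductSpace ℂ H]

/-- Energy estimate for a curve `w` with right derivative `g`. -/
theorem norm_le_exp_mul_of_re_inner_le {w g : ℝ → H} {c : ℝ}
    (hw : ContinuousOn w (Set.Ici 0))
    (hd : ∀ t, 0 ≤ t → HasDerivWithinAt w (g t) (Set.Ici t) t)
    (hg : ∀ t, 0 ≤ t → (inner ℂ (w t) (g t)).re ≤ -c * ‖w t‖ ^ 2) {t : ℝ} (ht : 0 ≤ t) :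
    ‖w t‖ ≤ Real.exp (-c * t) * ‖w 0‖ := by
  let _ : InnerProductSpace ℝ H := InnerProductSpace.complexToReal
  have h1 : ∀ s, 0 ≤ s → HasDerivWithinAt (fun s => Real.exp (2 * c * s) * ‖w s‖ ^ 2)
      (Real.exp (2 * c * s) * (2 * c) * ‖w s‖ ^ 2 +
        Real.exp (2 * c * s) * (2 * (inner ℂ (w s) (g s)).re)) (Set.Ici s) s := by
    intro s hs
    have e1 : HasDerivAt (fun s => Real.exp (2 * c * s)) (Real.exp (2 * c * s) * (2 * c)) s := by
      simpa using ((hasDerivAt_id s).const_mul (2 * c)).exp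
    have e2 := (hd s hs).norm_sq
    exact e1.hasDerivWithinAt.mul e2
  have h2 : Real.exp (2 * c * t) * ‖w t‖ ^ 2 ≤ ‖w 0‖ ^ 2 := by
    -- `e^{2cs}‖w‖²` has nonpositive right derivative, so it stays below its initial value.
    refine image_le_of_deriv_right_le_deriv_boundary (a := 0) (b := t)
      (f := fun s => Real.exp (2 * c * s) * ‖w s‖ ^ 2) (B := fun _ => ‖w 0‖ ^ 2)
      (B' := fun _ => 0) ?_ (fun s hs => h1 s hs.1) (by simp) continuousOn_const
      (fun s _ => (hasDerivAt_const s _).hasDerivWithinAt) ?_ ⟨ht, le_rfl⟩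
    · exact ((by fun_prop : Continuous fun s : ℝ => Real.exp (2 * c * s)).continuousOn).mul
        ((hw.mono Set.Icc_subset_Ici_self).norm.pow 2)
    · intro s hs
      have := hg s hs.1
      have h3 := Real.exp_pos (2 * c * s)
      have : Real.exp (2 * c * s) * (c * ‖w s‖ ^ 2 + (inner ℂ (w s) (g s)).re) ≤ 0 :=
        mul_nonpos_of_nonneg_of_nonpos h3.le (by linarith)
      linarith
  have h3 : Real.exp (c * t) * ‖w t‖ ≤ ‖w 0‖ := by
    refine (sq_le_sq₀ (by positivity) (norm_nonneg _)).1 ?_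
    rw [mul_pow, ← Real.exp_nat_mul]
    have e : ((2 : ℕ) : ℝ) * (c * t) = 2 * c * t := by push_cast; ring
    rwa [e]
  calc ‖w t‖ = Real.exp (-c * t) * (Real.exp (c * t) * ‖w t‖) := by
        rw [← mul_assoc, ← Real.exp_add]; simp
    _ ≤ _ := by gcongr

end Energy

/-! ### Exponentials of bounded dissipative operators -/

section Exponential

open NormedSpace

variable {H : Type*} [NormedAddCommGroup H] [InnerProductSpace ℂ H] [CompleteSpace H]

theorem hasDerivAt_exp_smul_apply (C : H →L[ℂ] H) (x : H) (t : ℝ) :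
    HasDerivAt (fun s : ℝ => exp (s • C) x) (C (exp (t • C) x)) t :=
  ((ContinuousLinearMap.apply ℂ H x).restrictScalars ℝ).hasFDerivAt.comp_hasDerivAt t
    (hasDerivAt_exp_smul_const' (𝕂 := ℝ) C t)

theorem exp_add_smul_apply (C : H →L[ℂ] H) (s t : ℝ) (x : H) :
    exp ((s + t) • C) x = exp (s • C) (exp (t • C) x) := by
  let _ : NormedAlgebra ℚ (H →L[ℂ] H) := .restrictScalars ℚ ℂ _
  rw [add_smul, exp_add_of_commute (((Commute.refl C).smul_right t).smul_left s)]
  rfl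

theorem norm_exp_smul_apply_le {C : H →L[ℂ] H} (hC : ∀ y, (inner ℂ y (C y)).re ≤ 0) {t : ℝ}
    (ht : 0 ≤ t) (x : H) : ‖exp (t • C) x‖ ≤ ‖x‖ := by
  have := norm_le_exp_mul_of_re_inner_le (w := fun s : ℝ => exp (s • C) x)
    (g := fun s : ℝ => C (exp (s • C) x)) (c := 0)
    (fun s _ => (hasDerivAt_exp_smul_apply C x s).continuousAt.continuousWithinAt)
    (fun s _ => (hasDerivAt_exp_smul_apply C x s).hasDerivWithinAt)
    (fun s _ => by simpa using hC _) ht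
  simpa using this

/-- The path `s ↦ e^{tD} e^{s(C-D)} x` joins `e^{tD}x` to `e^{tC}x`. Its derivative is `e^{(t-s)D}
e^{sC} (C - D)x`, a product of contractions applied to `(C - D)x`. -/
theorem norm_exp_smul_sub_exp_smul_le {C D : H →L[ℂ] H} (hCD : Commute C D)
    (hC : ∀ y, (inner ℂ y (C y)).re ≤ 0) (hD : ∀ y, (inner ℂ y (D y)).re ≤ 0)
    {t : ℝ} (ht : 0 ≤ t) (x : H) :
    ‖exp (t • C) x - exp (t • D) x‖ ≤ ‖C x - D x‖ * t := by
  let _ : NormedAlgebra ℚ (H →L[ℂ] H) := .restrictScalars ℚ ℂ _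
  have e : ∀ s : ℝ, exp (t • D) * exp (s • (C - D)) = exp ((t - s) • D) * exp (s • C) := by
    intro s
    rw [← exp_add_of_commute, ← exp_add_of_commute]
    · congr 1; module
    · exact (hCD.symm.smul_right s).smul_left _
    · exact ((hCD.symm.sub_right (Commute.refl D)).smul_right s).smul_left _
  have hd : ∀ s : ℝ, HasDerivAt (fun s : ℝ => exp (t • D) (exp (s • (C - D)) x))
      (exp (t • D) (exp (s • (C - D)) ((C - D) x))) s := by
    intro s
    have h1 := ((exp (t • D)).restrictScalars ℝ).hasFDerivAt.comp_hasDerivAt s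
      (hasDerivAt_exp_smul_apply (C - D) x s)
    have h2 : (C - D) (exp (s • (C - D)) x) = exp (s • (C - D)) ((C - D) x) :=
      DFunLike.congr_fun (((Commute.refl (C - D)).smul_right s).exp_right).eq x
    rw [← h2]
    exact h1
  have := norm_image_sub_le_of_norm_deriv_right_le_segment (a := 0) (b := t)
    (f := fun s : ℝ => exp (t • D) (exp (s • (C - D)) x)) (C := ‖C x - D x‖)
    (fun s _ => (hd s).continuousAt.continuousWithinAt)
    (fun s _ => (hd s).hasDerivWithinAt) ?_ t ⟨ht, le_rfl⟩
  · have e1 : exp (t • D) (exp (t • (C - D)) x) = exp (t • C) x := by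
      simpa using DFunLike.congr_fun (e t) x
    simpa [e1] using this
  · intro s hs
    have e2 : exp (t • D) (exp (s • (C - D)) ((C - D) x)) =
        exp ((t - s) • D) (exp (s • C) ((C - D) x)) := DFunLike.congr_fun (e s) ((C - D) x)
    rw [e2]
    exact (norm_exp_smul_apply_le hD (by linarith [hs.2]) _).trans
      (norm_exp_smul_apply_le hC hs.1 _)

theorem norm_exp_smul_sub_le {C : H →L[ℂ] H} (hC : ∀ y, (inner ℂ y (C y)).re ≤ 0)
    {t : ℝ} (ht : 0 ≤ t) (x : H) : ‖exp (t • C) x - x‖ ≤ ‖C x‖ * t := by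
  simpa using norm_exp_smul_sub_exp_smul_le (Commute.zero_right C) hC (by simp) ht x

/-- The first-order bound at `C x` controls the derivative of `e^{sC}x - sCx`; the sharp factor
`1/2` is not needed. -/
theorem norm_exp_smul_sub_sub_le {C : H →L[ℂ] H} (hC : ∀ y, (inner ℂ y (C y)).re ≤ 0)
    {t : ℝ} (ht : 0 ≤ t) (x : H) :
    ‖exp (t • C) x - x - t • C x‖ ≤ ‖C (C x)‖ * t * t := by
  have hd : ∀ s : ℝ, HasDerivAt (fun s : ℝ => exp (s • C) x - s • C x)
      (exp (s • C) (C x) - C x) s := by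
    intro s
    have h2 : C (exp (s • C) x) = exp (s • C) (C x) :=
      DFunLike.congr_fun (((Commute.refl C).smul_right s).exp_right).eq x
    rw [← h2]
    have h3 := (hasDerivAt_exp_smul_apply C x s).sub ((hasDerivAt_id s).smul_const (C x))
    rw [one_smul] at h3
    exact h3
  have := norm_image_sub_le_of_norm_deriv_right_le_segment (a := 0) (b := t)
    (f := fun s : ℝ => exp (s • C) x - s • C x) (C := ‖C (C x)‖ * t)
    (fun s _ => (hd s).continuousAt.continuousWithinAt)
    (fun s _ => (hd s).hasDerivWithinAt) ?_ t ⟨ht, le_rfl⟩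
  · simpa [sub_right_comm] using this
  · intro s hs
    refine (norm_exp_smul_sub_le hC hs.1 (C x)).trans ?_
    gcongr
    exact hs.2.le

end Exponential

/-! ### Strong convergence from a dense set -/

section Density

variable {H : Type*} [NormedAddCommGroup H] [NormedSpace ℂ H]

/-- Strong convergence to zero of a bounded family extends to the closure. -/
theorem tendsto_zero_of_mem_closure {ι : Type*} {f : Filter ι} {F : ι → H →L[ℂ] H} {C : ℝ}
    {s : Set H} (hF : ∀ᶠ i in f, ∀ x, ‖F i x‖ ≤ C * ‖x‖)
    (hs : ∀ x ∈ s, Filter.Tendsto (fun i => F i x) f (𝓝 0)) {x : H} (hx : x ∈ closure s) :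
    Filter.Tendsto (fun i => F i x) f (𝓝 0) := by
  rw [Metric.tendsto_nhds]
  intro ε hε
  -- `|C| + 1` is used because `C` may be zero or negative.
  obtain ⟨y, hy, hxy⟩ := Metric.mem_closure_iff.1 hx (ε / (2 * (|C| + 1))) (by positivity)
  filter_upwards [hF, Metric.tendsto_nhds.1 (hs y hy) (ε / 2) (by positivity)] with i h1 h2
  rw [dist_zero_right] at h2 ⊢
  rw [dist_eq_norm] at hxy
  have h3 : ‖F i (x - y)‖ ≤ (|C| + 1) * ‖x - y‖ :=
    (h1 _).trans (by gcongr; linarith [le_abs_self C])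
  have h4 : (|C| + 1) * ‖x - y‖ < ε / 2 := by
    rw [lt_div_iff₀ (by positivity)] at hxy
    linarith
  calc ‖F i x‖ = ‖F i (x - y) + F i y‖ := by simp
    _ ≤ ‖F i (x - y)‖ + ‖F i y‖ := norm_add_le _ _
    _ < ε := by linarith

/-- Strong convergence of a bounded sequence extends to the closure. -/
theorem cauchySeq_of_mem_closure {F : ℕ → H →L[ℂ] H} {C : ℝ}
    {s : Set H} (hF : ∀ n x, ‖F n x‖ ≤ C * ‖x‖)
    (hs : ∀ x ∈ s, CauchySeq (fun i => F i x)) {x : H} (hx : x ∈ closure s) :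
    CauchySeq (fun i => F i x) := by
  have key : ∀ y : H, CauchySeq (fun i => F i y) ↔
      Filter.Tendsto (fun p : ℕ × ℕ => (F p.1 - F p.2) y) Filter.atTop (𝓝 0) := by
    intro y
    rw [cauchySeq_iff_tendsto_dist_atTop_0]
    simp only [dist_eq_norm, sub_apply]
    exact tendsto_zero_iff_norm_tendsto_zero.symm
  rw [key]
  refine tendsto_zero_of_mem_closure (C := C + C) (s := s) (.of_forall fun p x => ?_)
    (fun y hy => (key y).1 (hs y hy)) hx
  rw [add_mul]
  exact (norm_sub_le _ _).trans (add_le_add (hF _ _) (hF _ _))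

end Density

/-! ### Yosida approximations -/

section Yosida

variable {H : Type*} [NormedAddCommGroup H] [InnerProductSpace ℂ H] [CompleteSpace H]

/-- The Yosida approximation `(L - l⁻¹)⁻¹` of the (possibly multivalued) inverse of `L`. -/
noncomputable def yosida (L : H →L[ℂ] H) (l : ℝ) : H →L[ℂ] H :=
  -((l : ℂ) • Ring.inverse (1 - (l : ℂ) • L))

variable {ω : ℝ} {L : H →L[ℂ] H} {l : ℝ}

/-- Every vector has the form `x - lLx`, so this substitution lets the later estimates avoid the
inverse. -/
theorem yosida_apply_sub (hω : 0 < ω) (hL : InverseDissipative ω L) (hl : 0 < l) (x : H) :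
    yosida L l (x - (l : ℂ) • L x) = -((l : ℂ) • x) := by
  have hu := hL.isUnit_one_sub hω (l := l) (by linarith)
  have := DFunLike.congr_fun (Ring.inverse_mul_cancel _ hu) x
  simp only [mul_apply_eq_comp] at this
  simp only [yosida, neg_apply, smul_apply]
  congr 2

theorem exists_sub_eq (hω : 0 < ω) (hL : InverseDissipative ω L) (hl : -ω < l) (y : H) :
    ∃ x, x - (l : ℂ) • L x = y := by
  have hu := hL.isUnit_one_sub hω (l := l) hl
  exact ⟨_, DFunLike.congr_fun (Ring.mul_inverse_cancel _ hu) y⟩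

theorem commute_yosida (hω : 0 < ω) (hL : InverseDissipative ω L) (hl : 0 < l) {N : H →L[ℂ] H}
    (hN : Commute N L) : Commute N (yosida L l) := by
  obtain ⟨u, hu⟩ := hL.isUnit_one_sub hω (l := l) (by linarith)
  rw [yosida, ← hu, Ring.inverse_unit]
  refine (Commute.smul_right (Commute.units_inv_right ?_) _).neg_right
  rw [hu]
  exact (Commute.one_right N).sub_right (hN.smul_right _)

/-- With `y = x - lLx` the left side is `l‖Lx‖`, and `l‖Lx‖ ≤ (l + ω)‖Lx‖ ≤ ‖y‖`. The bound is
uniform in `l`. -/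
theorem norm_yosida_apply_comp_le (hω : 0 < ω) (hL : InverseDissipative ω L) (hl : 0 < l)
    (y : H) : ‖yosida L l (L y)‖ ≤ ‖y‖ := by
  obtain ⟨x, rfl⟩ := exists_sub_eq hω hL (l := l) (by linarith) y
  have e : yosida L l (L (x - (l : ℂ) • L x)) = L (yosida L l (x - (l : ℂ) • L x)) :=
    (DFunLike.congr_fun (commute_yosida hω hL hl (Commute.refl L)).eq _).symm
  rw [e, yosida_apply_sub hω hL hl, map_neg, map_smul, norm_neg, norm_smul, Complex.norm_real,
    Real.norm_of_nonneg hl.le]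
  refine le_trans ?_ (hL.mul_norm_le l x)
  gcongr
  linarith

theorem re_inner_yosida_nonpos (hω : 0 < ω) (hL : InverseDissipative ω L) (hl : 0 < l)
    (y : H) : (inner ℂ y (yosida L l y)).re ≤ 0 := by
  obtain ⟨x, rfl⟩ := exists_sub_eq hω hL (l := l) (by linarith) y
  rw [yosida_apply_sub hω hL hl, inner_neg_right, inner_sub_left, inner_smul_right,
    inner_smul_right, inner_smul_left, inner_self_eq_norm_sq_to_K]
  have h1 := hL.re_nonpos hω x
  rw [← inner_conj_symm, Complex.conj_re] at h1
  have e : ((((‖x‖ : ℝ) : ℂ)) ^ 2).re = ‖x‖ ^ 2 := by norm_cast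
  simp [e]
  nlinarith [mul_nonneg hl.le (sq_nonneg ‖x‖), mul_nonneg (mul_self_nonneg l) (neg_nonneg.2 h1)]

/-- The sequence of Yosida approximations used to build the semigroup. -/
noncomputable def yosidaSeq (L : H →L[ℂ] H) (n : ℕ) : H →L[ℂ] H := yosida L (n + 1)

theorem re_inner_yosidaSeq_nonpos (hω : 0 < ω) (hL : InverseDissipative ω L) (n : ℕ) (y : H) :
    (inner ℂ y (yosidaSeq L n y)).re ≤ 0 :=
  re_inner_yosida_nonpos hω hL (by positivity) y

/-- On the range, `Y L(Lw) - Lw = l⁻¹ Y L w = O(l⁻¹)` for the approximation `Y` with parameter `l =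
n + 1`; uniform boundedness of `Y L` extends this to the closure. -/
theorem tendsto_yosidaSeq (hω : 0 < ω) (hL : InverseDissipative ω L) {y : H}
    (hy : y ∈ closure (L.range : Set H)) :
    Filter.Tendsto (fun n => yosidaSeq L n (L y)) Filter.atTop (𝓝 y) := by
  have hn : ∀ n : ℕ, (0 : ℝ) < n + 1 := fun n => by positivity
  have h0 : Filter.Tendsto (fun n => (yosidaSeq L n * L - 1) y) Filter.atTop (𝓝 0) := by
    refine tendsto_zero_of_mem_closure (C := 2) (s := L.range) (.of_forall fun n x => ?_) ?_ hy
    · have := norm_yosida_apply_comp_le hω hL (hn n) x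
      calc ‖yosidaSeq L n (L x) - x‖ ≤ ‖yosidaSeq L n (L x)‖ + ‖x‖ := norm_sub_le _ _
        _ ≤ 2 * ‖x‖ := by rw [yosidaSeq]; linarith
    · rintro _ ⟨w, rfl⟩
      have e : ∀ n : ℕ, ‖(yosidaSeq L n * L - 1) (L w)‖ ≤ ‖w‖ / ((n : ℝ) + 1) := by
        intro n
        have h1 := yosida_apply_sub hω hL (hn n) (L w)
        rw [map_sub, map_smul, sub_eq_iff_eq_add] at h1
        have h2 := norm_yosida_apply_comp_le hω hL (hn n) w
        have h3 : yosidaSeq L n (L w) =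
            (((n : ℝ) + 1 : ℝ) : ℂ) • ((yosidaSeq L n * L - 1) (L w)) := by
          rw [yosidaSeq, h1]
          simp [smul_sub]
          abel
        rw [le_div_iff₀ (hn n), mul_comm]
        rw [← yosidaSeq, h3, norm_smul, Complex.norm_real, Real.norm_of_nonneg (hn n).le] at h2
        exact h2
      refine squeeze_zero_norm e ?_
      exact tendsto_const_nhds.div_atTop
        (Filter.tendsto_atTop_add_const_right _ _ tendsto_natCast_atTop_atTop)
  have := h0.add_const y
  simpa using this

end Yosida

/-! ### Construction of the semigroup -/

section Generation

open NormedSpace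

variable {H : Type*} [NormedAddCommGroup H] [InnerProductSpace ℂ H]

/-- `T` is a degenerate semigroup that vanishes on `ker L`, lives on the closure of `ran L`, and is
generated there by the inverse of `L`. -/
structure IsGeneratedByInverse (L : H →L[ℂ] H) (T : ℝ≥0 → H →L[ℂ] H) : Prop where
  degenerate : IsDegenerateSemigroup T
  ker_eq : (T 0).ker = L.ker
  range_eq : (T 0).range = L.range.topologicalClosure
  mem_generatorGraph_iff : ∀ p : H × H,
    p ∈ generatorGraph T ↔ p.2 ∈ L.range.topologicalClosure ∧ p.1 = L p.2

theorem mem_closure_apply (L : H →L[ℂ] H) (x : H) : L x ∈ closure (L.range : Set H) :=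
  subset_closure ⟨x, rfl⟩

variable [CompleteSpace H] {ω : ℝ} {L : H →L[ℂ] H}

/-- The orthogonal projection onto the closure of the range of `L`. -/
noncomputable def rangeProj (L : H →L[ℂ] H) : H →L[ℂ] H := L.range.topologicalClosure.starProjection

theorem rangeProj_mem (L : H →L[ℂ] H) (x : H) : rangeProj L x ∈ closure (L.range : Set H) :=
  Submodule.starProjection_apply_mem L.range.topologicalClosure x

theorem rangeProj_eq_self {L : H →L[ℂ] H} {x : H} (hx : x ∈ closure (L.range : Set H)) :
    rangeProj L x = x :=
  (Submodule.starProjection_eq_self_iff (K := L.range.topologicalClosure)).2 hx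

theorem ker_rangeProj (hω : 0 < ω) (hL : InverseDissipative ω L) :
    (rangeProj L).ker = L.ker := by
  rw [rangeProj, Submodule.ker_starProjection, Submodule.orthogonal_closure,
    hL.orthogonal_range hω]

theorem range_rangeProj (L : H →L[ℂ] H) :
    (rangeProj L).range = L.range.topologicalClosure :=
  Submodule.range_starProjection _

theorem apply_rangeProj (hω : 0 < ω) (hL : InverseDissipative ω L) (x : H) :
    L (rangeProj L x) = L x := by
  have h : x - rangeProj L x ∈ L.ker := by
    rw [← ker_rangeProj hω hL, LinearMap.mem_ker]
    simp [rangeProj_eq_self (rangeProj_mem L x)]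
  rw [LinearMap.mem_ker] at h
  simp only [ContinuousLinearMap.coe_coe, map_sub, sub_eq_zero] at h
  exact h.symm

theorem commute_rangeProj (hω : 0 < ω) (hL : InverseDissipative ω L) :
    Commute (rangeProj L) L := by
  ext x
  change rangeProj L (L x) = L (rangeProj L x)
  rw [apply_rangeProj hω hL, rangeProj_eq_self (mem_closure_apply L x)]

theorem norm_rangeProj_le (x : H) : ‖rangeProj L x‖ ≤ ‖x‖ :=
  Submodule.norm_starProjection_apply_le _ x

/-- The semigroup generated by the `n`-th Yosida approximation. -/
noncomputable def yosidaExp (L : H →L[ℂ] H) (n : ℕ) (t : ℝ) : H →L[ℂ] H := exp (t • yosidaSeq L n)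

theorem commute_yosidaExp (hω : 0 < ω) (hL : InverseDissipative ω L) {N : H →L[ℂ] H}
    (hN : Commute N L) (n : ℕ) (t : ℝ) : Commute N (yosidaExp L n t) :=
  ((commute_yosida hω hL (by positivity) hN).smul_right t).exp_right

theorem norm_yosidaExp_apply_le (hω : 0 < ω) (hL : InverseDissipative ω L) (n : ℕ) {t : ℝ}
    (ht : 0 ≤ t) (x : H) : ‖yosidaExp L n t x‖ ≤ ‖x‖ :=
  norm_exp_smul_apply_le (re_inner_yosidaSeq_nonpos hω hL n) ht x

theorem cauchySeq_yosidaExp (hω : 0 < ω) (hL : InverseDissipative ω L) {t : ℝ} (ht : 0 ≤ t)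
    {x : H} (hx : x ∈ closure (L.range : Set H)) : CauchySeq (fun n => yosidaExp L n t x) := by
  refine cauchySeq_of_mem_closure (C := 1) (s := L.range)
    (fun n x => by simpa using norm_yosidaExp_apply_le hω hL n ht x) ?_ hx
  rintro _ ⟨w, rfl⟩
  change CauchySeq fun n => yosidaExp L n t (L w)
  -- `Y_n L` converges on the closure of the range, so `w` is first replaced by its projection,
  -- which has the same image under `L`.
  rw [← apply_rangeProj hω hL]
  set y := rangeProj L w
  have h1 := (tendsto_yosidaSeq hω hL (rangeProj_mem L w)).cauchySeq
  rw [cauchySeq_iff_tendsto_dist_atTop_0] at h1 ⊢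
  have h2 := h1.mul_const t
  rw [zero_mul] at h2
  refine squeeze_zero (fun _ => dist_nonneg) (fun p => ?_) h2
  rw [dist_eq_norm, dist_eq_norm]
  refine norm_exp_smul_sub_exp_smul_le ?_ (re_inner_yosidaSeq_nonpos hω hL _)
    (re_inner_yosidaSeq_nonpos hω hL _) ht _
  exact commute_yosida hω hL (by positivity)
    (commute_yosida hω hL (by positivity) (Commute.refl L)).symm

/-- `T` is the strong limit of the semigroups generated by the Yosida approximations. -/
def IsYosidaLimit (L : H →L[ℂ] H) (T : ℝ≥0 → H →L[ℂ] H) : Prop :=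
  ∀ (t : ℝ≥0) (x : H),
    Filter.Tendsto (fun n => yosidaExp L n t (rangeProj L x)) Filter.atTop (𝓝 (T t x))

theorem exists_isYosidaLimit (hω : 0 < ω) (hL : InverseDissipative ω L) :
    ∃ T, IsYosidaLimit L T := by
  have h : ∀ (t : ℝ≥0) (x : H), ∃ y, Filter.Tendsto
      (fun n => (yosidaExp L n t * rangeProj L) x) Filter.atTop (𝓝 y) := fun t x =>
    cauchySeq_tendsto_of_complete (cauchySeq_yosidaExp hω hL t.coe_nonneg (rangeProj_mem L x))
  choose S hS using h
  exact ⟨fun t => continuousLinearMapOfTendsto (fun n => yosidaExp L n t * rangeProj L)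
    (tendsto_pi_nhds.2 (hS t)), hS⟩

/-! ### Properties of the limit semigroup -/

section Limit

variable {T : ℝ≥0 → H →L[ℂ] H}

theorem limit_zero (hT : IsYosidaLimit L T) : T 0 = rangeProj L := by
  ext x
  refine tendsto_nhds_unique (hT 0 x) ?_
  simp [yosidaExp]

theorem limit_norm_le (hT : IsYosidaLimit L T) (hω : 0 < ω) (hL : InverseDissipative ω L)
    (t : ℝ≥0) (x : H) :
    ‖T t x‖ ≤ ‖x‖ :=
  le_of_tendsto (hT t x).norm (.of_forall fun n =>
    (norm_yosidaExp_apply_le hω hL n t.coe_nonneg _).trans (norm_rangeProj_le x))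

theorem limit_apply_rangeProj (hT : IsYosidaLimit L T) (t : ℝ≥0) (x : H) :
    T t (rangeProj L x) = T t x := by
  refine tendsto_nhds_unique (hT t _) ?_
  rw [rangeProj_eq_self (rangeProj_mem L x)]
  exact hT t x

theorem commute_limit (hT : IsYosidaLimit L T) (hω : 0 < ω) (hL : InverseDissipative ω L)
    {N : H →L[ℂ] H}
    (hN : Commute N L) (hN' : Commute N (rangeProj L)) (t : ℝ≥0) (x : H) :
    N (T t x) = T t (N x) := by
  refine tendsto_nhds_unique ((N.continuous.tendsto _).comp (hT t x)) ?_
  refine (hT t (N x)).congr fun n => ?_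
  have e1 : rangeProj L (N x) = N (rangeProj L x) := (DFunLike.congr_fun hN'.eq x).symm
  rw [e1]
  exact (DFunLike.congr_fun (commute_yosidaExp hω hL hN n t).eq _).symm

theorem limit_mem (hT : IsYosidaLimit L T) (hω : 0 < ω) (hL : InverseDissipative ω L)
    (t : ℝ≥0) (x : H) :
    T t x ∈ closure (L.range : Set H) := by
  rw [← limit_apply_rangeProj hT,
    ← commute_limit hT hω hL (commute_rangeProj hω hL) (Commute.refl _)]
  exact rangeProj_mem L _

theorem limit_add (hT : IsYosidaLimit L T) (hω : 0 < ω) (hL : InverseDissipative ω L)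
    (t s : ℝ≥0) (x : H) :
    T (t + s) x = T t (T s x) := by
  refine tendsto_nhds_unique (hT (t + s) x) ?_
  have h1 := hT t (T s x)
  rw [rangeProj_eq_self (limit_mem hT hω hL s x)] at h1
  -- The inner argument also varies with `n`; contractivity of the outer exponential absorbs the
  -- error.
  have h2 : Filter.Tendsto (fun n => yosidaExp L n t (yosidaExp L n s (rangeProj L x) - T s x))
      Filter.atTop (𝓝 0) := by
    refine squeeze_zero_norm (fun n => norm_yosidaExp_apply_le hω hL n t.coe_nonneg _) ?_
    have := ((hT s x).sub_const (T s x)).norm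
    simpa using this
  have h3 := h1.add h2
  rw [add_zero] at h3
  refine h3.congr fun n => ?_
  rw [← map_add, add_sub_cancel]
  exact (exp_add_smul_apply _ _ _ _).symm

theorem norm_limit_sub_le (hT : IsYosidaLimit L T) (hω : 0 < ω) (hL : InverseDissipative ω L)
    (t : ℝ≥0) (y : H) :
    ‖T t (L y) - L y‖ ≤ t * ‖y‖ := by
  have h := hT t (L y)
  rw [rangeProj_eq_self (mem_closure_apply L y)] at h
  refine le_of_tendsto (h.sub_const (L y)).norm (.of_forall fun n => ?_)
  refine (norm_exp_smul_sub_le (re_inner_yosidaSeq_nonpos hω hL _) t.coe_nonneg _).trans ?_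
  rw [mul_comm]
  gcongr
  exact norm_yosida_apply_comp_le hω hL (by positivity) y

theorem norm_limit_sub_sub_le (hT : IsYosidaLimit L T) (hω : 0 < ω) (hL : InverseDissipative ω L)
    (t : ℝ≥0) (z : H) :
    ‖T t (L (L z)) - L (L z) - (t : ℝ) • L z‖ ≤ ‖z‖ * t * t := by
  have h := hT t (L (L z))
  rw [rangeProj_eq_self (mem_closure_apply L (L z))] at h
  have h' := (h.sub_const (L (L z))).sub
    ((tendsto_yosidaSeq hω hL (mem_closure_apply L z)).const_smul (t : ℝ))
  refine le_of_tendsto h'.norm (.of_forall fun n => ?_)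
  refine (norm_exp_smul_sub_sub_le (re_inner_yosidaSeq_nonpos hω hL _) t.coe_nonneg _).trans ?_
  have hl : (0 : ℝ) < n + 1 := by positivity
  -- Regrouping `Y²L²` as `(YL)(YL)` allows the contraction bound to be used twice.
  have e : yosidaSeq L n (yosidaSeq L n (L (L z))) = yosidaSeq L n (L (yosidaSeq L n (L z))) := by
    congr 1
    exact (DFunLike.congr_fun (commute_yosida hω hL hl (Commute.refl L)).eq _).symm
  rw [e]
  have : ‖yosidaSeq L n (L (yosidaSeq L n (L z)))‖ ≤ ‖z‖ :=
    (norm_yosida_apply_comp_le hω hL hl _).trans (norm_yosida_apply_comp_le hω hL hl z)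
  have ht : (0 : ℝ) ≤ t := t.coe_nonneg
  gcongr

/-- Orbits are Lipschitz on the range of `L`; contractivity carries continuity to its closure, and
`T t` factors through the projection. -/
theorem continuous_limit (hT : IsYosidaLimit L T) (hω : 0 < ω) (hL : InverseDissipative ω L)
    (x : H) :
    Continuous fun t => T t x := by
  have key : ∀ w (s t : ℝ≥0), s ≤ t →
      ‖T t (L w) - T s (L w)‖ ≤ dist t s * ‖w‖ := by
    intro w s t hst
    obtain ⟨r, rfl⟩ := exists_add_of_le hst
    rw [limit_add hT hω hL, ← map_sub]
    refine (limit_norm_le hT hω hL s _).trans ?_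
    refine (norm_limit_sub_le hT hω hL r w).trans (le_of_eq ?_)
    congr 1
    rw [NNReal.dist_eq]; simp
  rw [continuous_iff_continuousAt]
  intro t
  have h : Filter.Tendsto (fun s => (T s - T t) (rangeProj L x)) (𝓝 t) (𝓝 0) := by
    refine tendsto_zero_of_mem_closure (C := 2) (s := L.range) (.of_forall fun s x => ?_) ?_
      (rangeProj_mem L x)
    · have h1 := limit_norm_le hT hω hL s x
      have h2 := limit_norm_le hT hω hL t x
      exact (norm_sub_le (T s x) (T t x)).trans (by linarith)
    · rintro _ ⟨w, rfl⟩
      have h0 : Filter.Tendsto (fun s : ℝ≥0 => dist s t * ‖w‖) (𝓝 t) (𝓝 0) := by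
        have : Continuous fun s : ℝ≥0 => dist s t * ‖w‖ := by fun_prop
        simpa using this.tendsto t
      refine squeeze_zero_norm (fun s => ?_) h0
      change ‖T s (L w) - T t (L w)‖ ≤ _
      rcases le_total t s with hst | hst
      · exact key w t s hst
      · rw [norm_sub_rev, dist_comm]
        exact key w s t hst
  have := h.add_const (T t x)
  simpa [limit_apply_rangeProj hT, ContinuousAt] using this

theorem isDegenerateSemigroup_limit (hT : IsYosidaLimit L T) (hω : 0 < ω) (hL : InverseDissipative ω L)
    :
    IsDegenerateSemigroup T where
  map_add t s _ _ := by ext x; exact limit_add hT hω hL t s x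
  continuousOn x := (continuous_limit hT hω hL x).continuousOn
  bounded := ⟨1, fun t _ _ => ContinuousLinearMap.opNorm_le_bound _ zero_le_one fun x => by
    simpa using limit_norm_le hT hω hL t x⟩
  tendsto_zero x := ((continuous_limit hT hω hL x).tendsto 0).mono_left nhdsWithin_le_nhds

/-- After composition with `L` the difference quotients are bounded uniformly in `t`, and on the
range of `L` the second-order estimate gives an error `O(t)`. -/
theorem tendsto_slope_limit (hT : IsYosidaLimit L T) (hω : 0 < ω) (hL : InverseDissipative ω L)
    {y : H}
    (hy : y ∈ closure (L.range : Set H)) :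
    Filter.Tendsto (fun t : ℝ≥0 => ((t : ℝ)⁻¹ : ℂ) • (T t (L y) - L y)) (𝓝[>] 0) (𝓝 y) := by
  have h : Filter.Tendsto (fun t : ℝ≥0 => (((t : ℝ)⁻¹ : ℂ) • (T t * L - L) - rangeProj L) y)
      (𝓝[>] 0) (𝓝 0) := by
    refine tendsto_zero_of_mem_closure (C := 2) (s := L.range) ?_ ?_ hy
    · filter_upwards [self_mem_nhdsWithin] with t ht x
      have ht' : (0 : ℝ) < t := ht
      have h1 := norm_limit_sub_le hT hω hL t x
      have h2 := norm_rangeProj_le (L := L) x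
      have h3 : ‖((t : ℝ)⁻¹ : ℂ) • (T t (L x) - L x)‖ ≤ ‖x‖ := by
        rw [norm_smul, norm_inv, Complex.norm_real, Real.norm_of_nonneg ht'.le,
          inv_mul_le_iff₀ ht']
        exact h1
      exact (norm_sub_le _ _).trans (by rw [two_mul]; exact add_le_add h3 h2)
    · rintro _ ⟨w, rfl⟩
      have h0 : Filter.Tendsto (fun t : ℝ≥0 => ‖w‖ * t) (𝓝[>] 0) (𝓝 0) := by
        have : Continuous fun t : ℝ≥0 => ‖w‖ * t := by fun_prop
        have h1 := this.tendsto 0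
        rw [NNReal.coe_zero, mul_zero] at h1
        exact h1.mono_left nhdsWithin_le_nhds
      refine squeeze_zero_norm' ?_ h0
      filter_upwards [self_mem_nhdsWithin] with t ht
      have ht' : (0 : ℝ) < t := ht
      have h1 := norm_limit_sub_sub_le hT hω hL t w
      have e : (((t : ℝ)⁻¹ : ℂ) • (T t * L - L) - rangeProj L) (L w) =
          ((t : ℝ)⁻¹ : ℂ) • (T t (L (L w)) - L (L w) - (t : ℝ) • L w) := by
        have e1 : ((t : ℝ)⁻¹ : ℂ) • ((t : ℝ) • L w) = L w := by
          rw [← Complex.coe_smul (t : ℝ), smul_smul, inv_mul_cancel₀, one_smul]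
          exact Complex.ofReal_ne_zero.2 ht'.ne'
        rw [smul_sub _ (T t (L (L w)) - L (L w)), e1, ← rangeProj_eq_self (mem_closure_apply L w)]
        simp [rangeProj_eq_self (mem_closure_apply L w)]
      change ‖(((t : ℝ)⁻¹ : ℂ) • (T t * L - L) - rangeProj L) (L w)‖ ≤ _
      rw [e, norm_smul, norm_inv, Complex.norm_real, Real.norm_of_nonneg ht'.le,
        inv_mul_le_iff₀ ht']
      linarith
  have := h.add_const y
  simpa [rangeProj_eq_self hy] using this

theorem isGeneratedByInverse_limit (hT : IsYosidaLimit L T) (hω : 0 < ω) (hL : InverseDissipative ω L)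
    :
    IsGeneratedByInverse L T where
  degenerate := isDegenerateSemigroup_limit hT hω hL
  ker_eq := by rw [limit_zero hT, ker_rangeProj hω hL]
  range_eq := by rw [limit_zero hT, range_rangeProj]
  mem_generatorGraph_iff := by
    rintro ⟨x, y⟩
    have hr : ∀ z, z ∈ (T 0).range ↔ z ∈ closure (L.range : Set H) := fun z => by
      rw [limit_zero hT, range_rangeProj]; rfl
    change (x ∈ (T 0).range ∧ y ∈ (T 0).range ∧ _) ↔ y ∈ closure (L.range : Set H) ∧ x = L y
    rw [hr, hr]
    constructor
    · rintro ⟨hx, hy, h⟩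
      -- Applying `L` to the difference quotients of `x` gives those of `L x`: they tend to `L y` by
      -- continuity and to `x` by the slope lemma.
      refine ⟨hy, tendsto_nhds_unique (tendsto_slope_limit hT hω hL hx) ?_⟩
      refine ((L.continuous.tendsto y).comp h).congr fun t => ?_
      simp [commute_limit hT hω hL (Commute.refl L) (commute_rangeProj hω hL).symm]
    · rintro ⟨hy, rfl⟩
      exact ⟨mem_closure_apply L y, hy, tendsto_slope_limit hT hω hL hy⟩

end Limit

theorem InverseDissipative.exists_isGeneratedByInverse (hω : 0 < ω)
    (hL : InverseDissipative ω L) : ∃ T, IsGeneratedByInverse L T := by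
  obtain ⟨T, hT⟩ := exists_isYosidaLimit hω hL
  exact ⟨T, isGeneratedByInverse_limit hT hω hL⟩

end Generation

/-! ### Uniqueness and exponential decay -/

section Uniqueness

variable {H : Type*} [NormedAddCommGroup H] [InnerProductSpace ℂ H] {T : ℝ≥0 → H →L[ℂ] H}

namespace IsDegenerateSemigroup

theorem continuous_apply (hT : IsDegenerateSemigroup T) (x : H) : Continuous fun t => T t x := by
  rw [continuous_iff_continuousAt]
  intro t
  rcases eq_or_lt_of_le (zero_le (a := t)) with rfl | ht
  · have h : ContinuousWithinAt (fun t => T t x) (Set.Ioi 0) 0 := hT.tendsto_zero x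
    rw [continuousWithinAt_Ioi_iff_Ici] at h
    have e : Set.Ici (0 : ℝ≥0) = Set.univ := Set.Ici_bot
    rwa [e, continuousWithinAt_univ] at h
  · exact (hT.continuousOn x).continuousAt (Ioi_mem_nhds ht)

/-- The axioms give the law for positive times; limits `s ↓ 0`, then `t ↓ 0`, add the endpoints. In
particular `T 0` is idempotent. -/
theorem add_apply (hT : IsDegenerateSemigroup T) (t s : ℝ≥0) (x : H) :
    T (t + s) x = T t (T s x) := by
  have pos : ∀ t s : ℝ≥0, 0 < t → 0 < s → T (t + s) x = T t (T s x) := fun t s ht hs => by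
    rw [hT.map_add t s ht hs]; rfl
  have right : ∀ t s : ℝ≥0, 0 < t → T (t + s) x = T t (T s x) := by
    intro t s ht
    rcases eq_or_lt_of_le (zero_le (a := s)) with rfl | hs
    · refine tendsto_nhds_unique (f := fun s => T (t + s) x) (l := 𝓝[>] 0) ?_ ?_
      · exact (((hT.continuous_apply x).comp (continuous_const.add continuous_id)).tendsto
          0).mono_left nhdsWithin_le_nhds
      · refine (((T t).continuous.tendsto _).comp (hT.tendsto_zero x)).congr' ?_
        filter_upwards [self_mem_nhdsWithin] with s hs
        exact (pos t s ht hs).symm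
    · exact pos t s ht hs
  rcases eq_or_lt_of_le (zero_le (a := t)) with rfl | ht
  · refine tendsto_nhds_unique (f := fun t => T (t + s) x) (l := 𝓝[>] 0) ?_ ?_
    · exact (((hT.continuous_apply x).comp (continuous_id.add continuous_const)).tendsto
        0).mono_left nhdsWithin_le_nhds
    · refine (hT.tendsto_zero (T s x)).congr' ?_
      filter_upwards [self_mem_nhdsWithin] with t ht
      exact (right t s ht).symm
  · exact right t s ht

theorem apply_comm (hT : IsDegenerateSemigroup T) (t s : ℝ≥0) (x : H) :
    T t (T s x) = T s (T t x) := by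
  rw [← hT.add_apply, add_comm, hT.add_apply]

theorem apply_zero_apply (hT : IsDegenerateSemigroup T) (t : ℝ≥0) (x : H) :
    T t (T 0 x) = T t x := by
  rw [← hT.add_apply, add_zero]

theorem zero_apply_apply (hT : IsDegenerateSemigroup T) (t : ℝ≥0) (x : H) :
    T 0 (T t x) = T t x := by
  rw [← hT.add_apply, zero_add]

/-- The right difference quotient at `t` is `T t` applied to the one at `0`. -/
theorem hasDerivWithinAt (hT : IsDegenerateSemigroup T) {p : H × H} (hp : p ∈ generatorGraph T)
    {t : ℝ} (ht : 0 ≤ t) :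
    HasDerivWithinAt (fun s : ℝ => T s.toNNReal p.1) (T t.toNNReal p.2) (Set.Ici t) t := by
  rw [← hasDerivWithinAt_Ioi_iff_Ici, hasDerivWithinAt_iff_tendsto_slope' Set.self_notMem_Ioi]
  have h1 : Filter.Tendsto (fun s : ℝ => (s - t).toNNReal) (𝓝[>] t) (𝓝[>] 0) := by
    refine tendsto_nhdsWithin_iff.2 ⟨?_, ?_⟩
    · have : Continuous fun s : ℝ => (s - t).toNNReal := by fun_prop
      have h := this.tendsto t
      simp only [sub_self, Real.toNNReal_zero] at h
      exact h.mono_left nhdsWithin_le_nhds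
    · filter_upwards [self_mem_nhdsWithin] with s hs
      exact Real.toNNReal_pos.2 (sub_pos.2 hs)
  refine (((T t.toNNReal).continuous.tendsto _).comp (hp.2.2.comp h1)).congr' ?_
  filter_upwards [self_mem_nhdsWithin] with s hs
  have hs' : 0 < s - t := sub_pos.2 hs
  have e : s.toNNReal = t.toNNReal + (s - t).toNNReal := by
    rw [← Real.toNNReal_add ht hs'.le]; congr 1; ring
  simp only [Function.comp_apply, slope_def_module]
  rw [map_smul, map_sub, ← hT.add_apply, ← e, Real.coe_toNNReal _ hs'.le]
  rw [← Complex.ofReal_inv, Complex.coe_smul]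

theorem mem_generatorGraph_apply (hT : IsDegenerateSemigroup T) {p : H × H}
    (hp : p ∈ generatorGraph T) (t : ℝ≥0) : (T t p.1, T t p.2) ∈ generatorGraph T := by
  refine ⟨⟨T t p.1, hT.zero_apply_apply t _⟩, ⟨T t p.2, hT.zero_apply_apply t _⟩, ?_⟩
  refine (((T t).continuous.tendsto _).comp hp.2.2).congr fun s => ?_
  simp only [Function.comp_apply]
  rw [map_smul, map_sub, hT.apply_comm t s]

end IsDegenerateSemigroup

namespace IsGeneratedByInverse

variable {L : H →L[ℂ] H} {T' : ℝ≥0 → H →L[ℂ] H}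

theorem mem_closure_iff (hT : IsGeneratedByInverse L T) (x : H) :
    x ∈ closure (L.range : Set H) ↔ T 0 x = x := by
  have h : x ∈ closure (L.range : Set H) ↔ x ∈ (T 0).range := by rw [hT.range_eq]; rfl
  rw [h]
  constructor
  · rintro ⟨y, rfl⟩
    exact hT.degenerate.zero_apply_apply 0 y
  · intro h
    exact ⟨x, h⟩

theorem zero_apply_mem (hT : IsGeneratedByInverse L T) (x : H) :
    T 0 x ∈ closure (L.range : Set H) :=
  (hT.mem_closure_iff _).2 (hT.degenerate.zero_apply_apply 0 x)

theorem apply_zero_apply (hT : IsGeneratedByInverse L T) (x : H) : L (T 0 x) = L x := by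
  have h : x - T 0 x ∈ L.ker := by
    rw [← hT.ker_eq, LinearMap.mem_ker]
    simp [hT.degenerate.zero_apply_apply]
  rw [LinearMap.mem_ker, ContinuousLinearMap.coe_coe, map_sub, sub_eq_zero] at h
  exact h.symm

/-- Two projections with the same kernel and range coincide. -/
theorem zero_eq_zero (hT : IsGeneratedByInverse L T) (hT' : IsGeneratedByInverse L T') :
    T 0 = T' 0 := by
  ext x
  have h : x - T 0 x ∈ (T' 0).ker := by
    rw [hT'.ker_eq, LinearMap.mem_ker, ContinuousLinearMap.coe_coe, map_sub,
      hT.apply_zero_apply, sub_self]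
  rw [LinearMap.mem_ker, ContinuousLinearMap.coe_coe, map_sub, sub_eq_zero,
    (hT'.mem_closure_iff _).1 (hT.zero_apply_mem x)] at h
  exact h.symm

theorem pair_mem (hT : IsGeneratedByInverse L T) {y : H} (hy : y ∈ closure (L.range : Set H)) :
    (L y, y) ∈ generatorGraph T :=
  (hT.mem_generatorGraph_iff _).2 ⟨hy, rfl⟩

/-- The generator graph is invariant under `T t`, and its elements are pairs `(L y, y)`. -/
theorem apply_comm (hT : IsGeneratedByInverse L T) (t : ℝ≥0) {y : H}
    (hy : y ∈ closure (L.range : Set H)) : T t (L y) = L (T t y) :=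
  ((hT.mem_generatorGraph_iff _).1
    (hT.degenerate.mem_generatorGraph_apply (hT.pair_mem hy) t)).2

theorem continuous_toNNReal (hT : IsGeneratedByInverse L T) (x : H) :
    Continuous fun s : ℝ => T s.toNNReal x :=
  (hT.degenerate.continuous_apply x).comp continuous_real_toNNReal

theorem re_inner_apply_le {ω : ℝ} (hL : InverseDissipative ω L) (x : H) :
    (inner ℂ (L x) x).re ≤ -ω * ‖L x‖ ^ 2 := by
  rw [← inner_conj_symm, Complex.conj_re]
  exact hL x

/-- The difference `w` of two orbits from `L y` has right derivative `g` with `w = L g` and `w 0 =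
0`, so the energy estimate gives `w = 0`. -/
theorem eq_of_inverseDissipative {ω : ℝ} (hL : InverseDissipative ω L)
    (hT : IsGeneratedByInverse L T) (hT' : IsGeneratedByInverse L T') : T = T' := by
  have key : ∀ (t : ℝ≥0) (y : H), y ∈ closure (L.range : Set H) → T t (L y) = T' t (L y) := by
    intro t y hy
    have h := norm_le_exp_mul_of_re_inner_le (c := ω)
      (w := fun s : ℝ => T s.toNNReal (L y) - T' s.toNNReal (L y))
      (g := fun s : ℝ => T s.toNNReal y - T' s.toNNReal y)
      ((hT.continuous_toNNReal _).sub (hT'.continuous_toNNReal _)).continuousOn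
      (fun s hs => (hT.degenerate.hasDerivWithinAt (hT.pair_mem hy) hs).sub
        (hT'.degenerate.hasDerivWithinAt (hT'.pair_mem hy) hs))
      (fun s _ => by
        rw [hT.apply_comm _ hy, hT'.apply_comm _ hy, ← map_sub]
        exact re_inner_apply_le hL _) t.coe_nonneg
    simp only [Real.toNNReal_coe, Real.toNNReal_zero, hT.zero_eq_zero hT', sub_self, norm_zero,
      mul_zero, norm_le_zero_iff, sub_eq_zero] at h
    exact h
  ext t x
  rw [← hT.degenerate.apply_zero_apply, ← hT'.degenerate.apply_zero_apply t x,
    ← hT.zero_eq_zero hT']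
  have hc : IsClosed {z | T t z = T' t z} := isClosed_eq (T t).continuous (T' t).continuous
  refine closure_minimal ?_ hc (hT.zero_apply_mem x)
  rintro _ ⟨w, rfl⟩
  have := key t (T 0 w) (hT.zero_apply_mem w)
  rwa [hT.apply_zero_apply] at this

theorem isExponentiallyStable {ω : ℝ} (hω : 0 < ω) (hL : InverseDissipative ω L)
    (hT : IsGeneratedByInverse L T) : IsExponentiallyStable T := by
  have key : ∀ (t : ℝ≥0) (y : H), y ∈ closure (L.range : Set H) →
      ‖T t (L y)‖ ≤ Real.exp (-ω * t) * ‖L y‖ := by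
    intro t y hy
    have h := norm_le_exp_mul_of_re_inner_le (c := ω)
      (w := fun s : ℝ => T s.toNNReal (L y)) (g := fun s : ℝ => T s.toNNReal y)
      (hT.continuous_toNNReal _).continuousOn
      (fun s hs => hT.degenerate.hasDerivWithinAt (hT.pair_mem hy) hs)
      (fun s _ => by
        rw [hT.apply_comm _ hy]
        exact re_inner_apply_le hL _) t.coe_nonneg
    simpa [(hT.mem_closure_iff _).1 (mem_closure_apply L y)] using h
  -- The `+ 1` keeps the constant positive when `T 0 = 0`.
  refine ⟨‖T 0‖ + 1, ω, by positivity, hω, fun t => ?_⟩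
  refine ContinuousLinearMap.opNorm_le_bound _ (by positivity) fun x => ?_
  rw [← hT.degenerate.apply_zero_apply]
  have hc : IsClosed {z | ‖T t z‖ ≤ Real.exp (-ω * t) * ‖z‖} :=
    isClosed_le (T t).continuous.norm (by fun_prop)
  have h : ‖T t (T 0 x)‖ ≤ Real.exp (-ω * t) * ‖T 0 x‖ := by
    refine closure_minimal ?_ hc (hT.zero_apply_mem x)
    rintro _ ⟨w, rfl⟩
    have := key t (T 0 w) (hT.zero_apply_mem w)
    rwa [hT.apply_zero_apply] at this
  have h2 : ‖T 0 x‖ ≤ (‖T 0‖ + 1) * ‖x‖ :=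
    ((T 0).le_opNorm x).trans (by gcongr; linarith)
  calc ‖T t (T 0 x)‖ ≤ Real.exp (-ω * t) * ((‖T 0‖ + 1) * ‖x‖) := h.trans (by gcongr)
    _ = _ := by ring

end IsGeneratedByInverse

end Uniqueness

/-! ### From the pencil to bounded operators -/

section PencilInverse

variable {X Z : Type*}
  [NormedAddCommGroup X] [InnerProductSpace ℂ X]
  [NormedAddCommGroup Z] [InnerProductSpace ℂ Z]
  {E : X →L[ℂ] Z} {A : X →ₗ.[ℂ] Z}

theorem pencil_apply (E : X →L[ℂ] Z) (A : X →ₗ.[ℂ] Z) (l : ℂ) (x : A.domain) :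
    pencil E A l x = l • E x - A x := rfl

theorem zero_mem_pencilResolventSet_iff :
    (0 : ℂ) ∈ pencilResolventSet E A ↔ Function.Bijective (fun x : A.domain => A x) := by
  have e : ⇑(pencil E A 0) = (Equiv.neg Z) ∘ fun x : A.domain => A x := by
    ext x; simp [pencil_apply]
  change Function.Bijective (pencil E A 0) ↔ _
  rw [e]
  exact Function.Bijective.of_comp_iff' (Equiv.neg Z).bijective _

/-- `B` is a bounded everywhere defined inverse of `A`. -/
structure IsBoundedInverse (A : X →ₗ.[ℂ] Z) (B : Z →L[ℂ] X) : Prop where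
  right_inv : ∀ z, ∃ x : A.domain, (x : X) = B z ∧ A x = z
  left_inv : ∀ x : A.domain, B (A x) = x

namespace IsBoundedInverse

variable {B : Z →L[ℂ] X}

theorem bijective (hB : IsBoundedInverse A B) : Function.Bijective (fun x : A.domain => A x) := by
  constructor
  · intro x y h
    apply Subtype.ext
    rw [← hB.left_inv x, ← hB.left_inv y]
    exact congrArg B h
  · intro z
    obtain ⟨x, -, h⟩ := hB.right_inv z
    exact ⟨x, h⟩

/-- Factorisation `lE - A = -(1 - lEB)A`. -/
theorem mem_pencilResolventSet (hB : IsBoundedInverse A B) {l : ℂ}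
    (hu : IsUnit (1 - l • (E ∘L B))) : l ∈ pencilResolventSet E A := by
  obtain ⟨u, hu⟩ := hu
  have hb : Function.Bijective ⇑(1 - l • (E ∘L B)) := by
    rw [← hu]
    exact (ContinuousLinearEquiv.ofUnit u).bijective
  have e : ⇑(pencil E A l) =
      (Equiv.neg Z) ∘ ⇑(1 - l • (E ∘L B)) ∘ fun x : A.domain => A x := by
    ext x
    simp [pencil_apply, hB.left_inv]
  change Function.Bijective (pencil E A l)
  rw [e]
  exact (Equiv.neg Z).bijective.comp (hb.comp hB.bijective)

theorem inverseDissipative (hB : IsBoundedInverse A B) {ω : ℝ}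
    (h : ∀ x : A.domain, (inner ℂ (A x) (E x)).re ≤ -ω * ‖E x‖ ^ 2) :
    InverseDissipative ω (E ∘L B) := by
  intro z
  obtain ⟨x, hx, rfl⟩ := hB.right_inv z
  have := h x
  rwa [hx] at this

end IsBoundedInverse

variable [CompleteSpace X] [CompleteSpace Z]

/-- For `u` in `D(A)`, `⟨x, u⟩ = ⟨x, BAu⟩ = ⟨B*x, Au⟩`, which puts `B*x` in `D(A*)` with `A*B*x =
x`. -/
theorem IsBoundedInverse.adjoint (hdense : Dense (A.domain : Set X)) {B : Z →L[ℂ] X}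
    (hB : IsBoundedInverse A B) :
    IsBoundedInverse A.adjoint (ContinuousLinearMap.adjoint B) where
  right_inv x := by
    have h : ∀ u : A.domain,
        inner ℂ x (u : X) = inner ℂ (ContinuousLinearMap.adjoint B x) (A u) := by
      intro u
      rw [ContinuousLinearMap.adjoint_inner_left, hB.left_inv]
    exact ⟨⟨_, LinearPMap.mem_adjoint_domain_of_exists _ ⟨x, h⟩⟩, rfl,
      LinearPMap.adjoint_apply_eq hdense _ h⟩
  left_inv z := by
    refine ext_inner_right ℂ fun w => ?_
    obtain ⟨u, hu, hw⟩ := hB.right_inv w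
    rw [ContinuousLinearMap.adjoint_inner_left, ← hu,
      LinearPMap.adjoint_isFormalAdjoint hdense z u, hw]

theorem pencilInverse_spec (hA : A.IsClosed) {l : ℂ} (hl : l ∈ pencilResolventSet E A) (z : Z) :
    ∃ x : A.domain, (x : X) = pencilInverse E A l z ∧ l • E x - A x = z := by
  rw [pencilInverse, dif_pos ⟨hA, hl⟩]
  exact ⟨(LinearEquiv.ofBijective (pencil E A l) hl).symm z, rfl,
    (LinearEquiv.ofBijective (pencil E A l) hl).apply_symm_apply z⟩

theorem pencilInverse_apply_sub (hA : A.IsClosed) {l : ℂ} (hl : l ∈ pencilResolventSet E A)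
    (x : A.domain) : pencilInverse E A l (l • E x - A x) = x := by
  obtain ⟨y, hy, h⟩ := pencilInverse_spec hA hl (l • E x - A x)
  rw [← hy, hl.1 h]

theorem isBoundedInverse_neg_pencilInverse (hA : A.IsClosed)
    (h0 : (0 : ℂ) ∈ pencilResolventSet E A) : IsBoundedInverse A (-pencilInverse E A 0) where
  right_inv z := by
    obtain ⟨x, hx, h⟩ := pencilInverse_spec hA h0 z
    refine ⟨-x, by simp [hx], ?_⟩
    rw [LinearPMap.map_neg, ← h]; simp
  left_inv x := by
    have := pencilInverse_apply_sub hA h0 x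
    rw [zero_smul, zero_sub, map_neg] at this
    exact this

theorem rightPseudoResolvent_apply (E : X →L[ℂ] Z) (A : X →ₗ.[ℂ] Z) (l : ℂ) (x : X) :
    rightPseudoResolvent E A l x = -pencilInverse E A l (E x) := rfl

/-- For `y = R(l)x`, the equation `(A - lE)y = Ex` rearranges to `Ay = E(x + ly)`. -/
theorem rightPseudoResolvent_eq_add (hA : A.IsClosed) (h0 : (0 : ℂ) ∈ pencilResolventSet E A)
    {l : ℂ} (hl : l ∈ pencilResolventSet E A) (x : X) :
    rightPseudoResolvent E A l x =
      rightPseudoResolvent E A 0 (x + l • rightPseudoResolvent E A l x) := by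
  obtain ⟨y, hy, h⟩ := pencilInverse_spec hA hl (E x)
  have h1 := pencilInverse_apply_sub hA h0 y
  have e : E (x + l • rightPseudoResolvent E A l x) = -A y := by
    rw [rightPseudoResolvent_apply, ← hy, map_add, map_smul, ← h]
    simp only [map_neg, smul_neg]
    abel
  rw [zero_smul, zero_sub] at h1
  rw [rightPseudoResolvent_apply E A 0, e, rightPseudoResolvent_apply, ← hy, h1]

theorem rightPseudoResolvent_apply_sub (hA : A.IsClosed) (h0 : (0 : ℂ) ∈ pencilResolventSet E A)
    {l : ℂ} (hl : l ∈ pencilResolventSet E A) (x : X) :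
    rightPseudoResolvent E A l (x - l • rightPseudoResolvent E A 0 x) =
      rightPseudoResolvent E A 0 x := by
  obtain ⟨y, hy, h⟩ := pencilInverse_spec hA h0 (E x)
  have h1 := pencilInverse_apply_sub hA hl y
  rw [zero_smul, zero_sub] at h
  rw [rightPseudoResolvent_apply E A 0, ← hy, rightPseudoResolvent_apply, ← h1]
  congr 2
  rw [map_sub, ← h, map_smul, h1]
  simp
  abel

theorem rightPseudoResolvent_ker (hA : A.IsClosed) (h0 : (0 : ℂ) ∈ pencilResolventSet E A)
    {l : ℂ} (hl : l ∈ pencilResolventSet E A) :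
    (rightPseudoResolvent E A l).ker = (rightPseudoResolvent E A 0).ker := by
  ext x
  simp only [LinearMap.mem_ker, ContinuousLinearMap.coe_coe]
  constructor
  · intro h
    have := rightPseudoResolvent_eq_add hA h0 hl x
    rw [h, smul_zero, add_zero] at this
    exact this.symm
  · intro h
    have := rightPseudoResolvent_apply_sub hA h0 hl x
    rwa [h, smul_zero, sub_zero] at this

theorem rightPseudoResolvent_range (hA : A.IsClosed) (h0 : (0 : ℂ) ∈ pencilResolventSet E A)
    {l : ℂ} (hl : l ∈ pencilResolventSet E A) :
    (rightPseudoResolvent E A l).range = (rightPseudoResolvent E A 0).range := by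
  ext y
  constructor
  · rintro ⟨x, rfl⟩
    exact ⟨_, (rightPseudoResolvent_eq_add hA h0 hl x).symm⟩
  · rintro ⟨x, rfl⟩
    exact ⟨_, rightPseudoResolvent_apply_sub hA h0 hl x⟩

/-- The substitution `y = x + lR(l)x`, with inverse `x = y - lR(0)y`, preserves the closed range and
turns the graph at `l` into the pairs `(R(0)y, y)`. -/
theorem mem_pseudoResolventGraph_iff (hA : A.IsClosed) (h0 : (0 : ℂ) ∈ pencilResolventSet E A)
    {l : ℂ} (hl : l ∈ pencilResolventSet E A) (p : X × X) :
    p ∈ pseudoResolventGraph (rightPseudoResolvent E A) l ↔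
      p.2 ∈ (rightPseudoResolvent E A 0).range.topologicalClosure ∧
        p.1 = rightPseudoResolvent E A 0 p.2 := by
  have hmem : ∀ x, rightPseudoResolvent E A 0 x ∈
      (rightPseudoResolvent E A 0).range.topologicalClosure := fun x =>
    Submodule.le_topologicalClosure _ ⟨x, rfl⟩
  rw [pseudoResolventGraph, Set.mem_ofPred_eq, rightPseudoResolvent_range hA h0 hl]
  constructor
  · rintro ⟨x, hx, rfl⟩
    have h := rightPseudoResolvent_eq_add hA h0 hl x
    refine ⟨Submodule.add_mem _ hx (Submodule.smul_mem _ _ ?_), h⟩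
    rw [h]
    exact hmem _
  · obtain ⟨a, y⟩ := p
    rintro ⟨hy, ha⟩
    obtain rfl : a = rightPseudoResolvent E A 0 y := ha
    refine ⟨y - l • rightPseudoResolvent E A 0 y,
      Submodule.sub_mem _ hy (Submodule.smul_mem _ _ (hmem y)), ?_⟩
    rw [rightPseudoResolvent_apply_sub hA h0 hl, sub_add_cancel]

theorem isAssociatedSemigroup_iff (hA : A.IsClosed) (h0 : (0 : ℂ) ∈ pencilResolventSet E A)
    (T : ℝ≥0 → X →L[ℂ] X) :
    IsAssociatedSemigroup (rightPseudoResolvent E A) (pencilResolventSet E A) T ↔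
      IsGeneratedByInverse (rightPseudoResolvent E A 0) T := by
  constructor
  · intro h
    refine ⟨h.degenerate, h.ker_eq 0 h0, h.range_eq 0 h0, fun p => ?_⟩
    rw [h.generator_eq 0 h0, mem_pseudoResolventGraph_iff hA h0 h0]
  · intro h
    refine ⟨h.degenerate, fun l hl => ?_, fun l hl => ?_, fun l hl => ?_⟩
    · rw [rightPseudoResolvent_ker hA h0 hl, h.ker_eq]
    · rw [rightPseudoResolvent_range hA h0 hl, h.range_eq]
    · ext p
      rw [h.mem_generatorGraph_iff, mem_pseudoResolventGraph_iff hA h0 hl]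

theorem norm_comp_pencilInverse_le (hA : A.IsClosed) {B : Z →L[ℂ] X} (hB : IsBoundedInverse A B)
    {ω l : ℝ} (hd : InverseDissipative ω (E ∘L B)) (hlω : -ω < l)
    (hl : (l : ℂ) ∈ pencilResolventSet E A) : ‖E ∘L pencilInverse E A l‖ ≤ (l + ω)⁻¹ := by
  have hpos : 0 < l + ω := by linarith
  refine ContinuousLinearMap.opNorm_le_bound _ (inv_nonneg.2 hpos.le) fun z => ?_
  obtain ⟨y, hy, h⟩ := pencilInverse_spec hA hl z
  -- For `v = Ay` one has `EBv = Ey` and `v - lEBv = -z`.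
  have h1 := hd.mul_norm_le l (A y)
  rw [ContinuousLinearMap.comp_apply, hB.left_inv, norm_sub_rev, h] at h1
  rw [ContinuousLinearMap.comp_apply, ← hy, le_inv_mul_iff₀ hpos]
  exact h1

theorem norm_pencilInverse_comp_le (hA : A.IsClosed) (h0 : (0 : ℂ) ∈ pencilResolventSet E A)
    {ω l : ℝ} (hω : 0 < ω) (hd : InverseDissipative ω (rightPseudoResolvent E A 0))
    (hlω : -ω < l) (hl : (l : ℂ) ∈ pencilResolventSet E A) :
    ‖pencilInverse E A l ∘L E‖ ≤ (l + ω)⁻¹ := by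
  have hpos : 0 < l + ω := by linarith
  refine ContinuousLinearMap.opNorm_le_bound _ (inv_nonneg.2 hpos.le) fun x => ?_
  -- Writing `x = y - lR(0)y` gives `R(l)x = R(0)y`, so the bound is `mul_norm_le` for `R(0)`.
  obtain ⟨y, rfl⟩ := exists_sub_eq hω hd hlω x
  rw [le_inv_mul_iff₀ hpos, ← norm_neg ((pencilInverse E A l ∘L E) _)]
  change (l + ω) * ‖rightPseudoResolvent E A l _‖ ≤ _
  rw [rightPseudoResolvent_apply_sub hA h0 hl]
  exact hd.mul_norm_le l y

end PencilInverse

theorem mainTheorem5 {X Z : Type*}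
    [NormedAddCommGroup X] [InnerProductSpace ℂ X] [CompleteSpace X]
    [NormedAddCommGroup Z] [InnerProductSpace ℂ Z] [CompleteSpace Z]
    (E : X →L[ℂ] Z) (A : X →ₗ.[ℂ] Z)
    (hdense : Dense (A.domain : Set X)) (hclosed : A.IsClosed)
    (h0 : Function.Bijective (fun x : A.domain => A x)) :
    (0 : ℂ) ∈ pencilResolventSet E A ∧
    ∀ ω : ℝ, 0 < ω →
      (∀ x : A.domain, (inner ℂ (A x) (E x)).re ≤ -ω * ‖E x‖ ^ 2) →
      (∀ z : A.adjoint.domain,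
        (inner ℂ (A.adjoint z) (ContinuousLinearMap.adjoint E z)).re
          ≤ -ω * ‖ContinuousLinearMap.adjoint E z‖ ^ 2) →
      (∀ l : ℝ, -ω < l →
        (l : ℂ) ∈ pencilResolventSet E A ∧
        (l : ℂ) ∈ pencilResolventSet (ContinuousLinearMap.adjoint E) A.adjoint) ∧
      (∀ l : ℝ, -ω < l → ‖E ∘L pencilInverse E A l‖ ≤ (l + ω)⁻¹) ∧
      (∀ l : ℝ, -ω < l → ‖pencilInverse E A l ∘L E‖ ≤ (l + ω)⁻¹) ∧
      (∃! T : ℝ≥0 → X →L[ℂ] X,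
        IsAssociatedSemigroup (rightPseudoResolvent E A) (pencilResolventSet E A) T) ∧
      (∀ T : ℝ≥0 → X →L[ℂ] X,
        IsAssociatedSemigroup (rightPseudoResolvent E A) (pencilResolventSet E A) T →
          IsExponentiallyStable T) := by
  have h0' : (0 : ℂ) ∈ pencilResolventSet E A := zero_mem_pencilResolventSet_iff.2 h0
  refine ⟨h0', fun ω hω hE hE' => ?_⟩
  have hB := isBoundedInverse_neg_pencilInverse hclosed h0'
  have hB' := hB.adjoint hdense
  have hK := hB.inverseDissipative hE
  have hK' := hB'.inverseDissipative hE'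
  have hL : InverseDissipative ω (rightPseudoResolvent E A 0) := by
    -- `E*B*` is the adjoint of `BE = A⁻¹E`, so the hypothesis on `A*` transfers to `L`.
    have := hK'.adjoint hω
    rwa [ContinuousLinearMap.adjoint_comp, ContinuousLinearMap.adjoint_adjoint,
      ContinuousLinearMap.adjoint_adjoint] at this
  have hmem : ∀ l : ℝ, -ω < l → (l : ℂ) ∈ pencilResolventSet E A := fun l hl =>
    hB.mem_pencilResolventSet (hK.isUnit_one_sub hω hl)
  refine ⟨fun l hl => ⟨hmem l hl, hB'.mem_pencilResolventSet (hK'.isUnit_one_sub hω hl)⟩,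
    fun l hl => norm_comp_pencilInverse_le hclosed hB hK hl (hmem l hl),
    fun l hl => norm_pencilInverse_comp_le hclosed h0' hω hL hl (hmem l hl), ?_, ?_⟩
  · obtain ⟨T, hT⟩ := hL.exists_isGeneratedByInverse hω
    refine ⟨T, (isAssociatedSemigroup_iff hclosed h0' T).2 hT, fun T' hT' => ?_⟩
    exact IsGeneratedByInverse.eq_of_inverseDissipative hL
      ((isAssociatedSemigroup_iff hclosed h0' T').1 hT') hT
  · intro T hT
    exact ((isAssociatedSemigroup_iff hclosed h0' T).1 hT).isExponentiallyStable hω hL
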